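/- Let $\mathsf{Atm}$ be a set of propositional variables. Formulas are in negation normal form, $A ::= p \mid \bar p \mid A\wedge A \mid A\vee A \mid \Box A \mid \Diamond A$ with $p\in\mathsf{Atm}$; the negation $\bar A$ is defined by de Morgan duality and $A\supset B := \bar A\vee B$. For $X\subseteq\{n\in\mathbb N : n>1\}$ let $\mathsf K+\{\Diamond^nA\supset\Diamond A : n\in X\}$ be the Hilbert system given by all classical propositional tautologies, all formulas $\Box(A\supset B)\supset(\Box A\supset\Box B)$, all formulas $\Diamond^nA\supset\Diamond A$ with $n\in X$, modus ponens and necessitation. The completion of $X$ is $\hat X=\bigcup_{p\ge 0}X_p$, where $X_0=X$ and $X_{p+1}=X_p\cup\{m+n-1 : m,n\in X_p\}$. A nested sequent is a finite multiset of formulas and of boxed nested sequents $[\Delta]$; $\Gamma\{\ \}$ denotes a nested sequent with one hole, which may lie at any nesting depth, and $\Gamma\{\Delta\}$ the result of putting $\Delta$ into the hole. The (cut-free) system $\mathsf{nK}$ has the axioms $\Gamma\{p,\bar p\}$ with $p\in\mathsf{Atm}$ and the following rules: from $\Gamma\{A,B\}$ infer $\Gamma\{A\vee B\}$; from $\Gamma\{A\}$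 and $\Gamma\{B\}$ infer $\Gamma\{A\wedge B\}$; from $\Gamma\{[A]\}$ infer $\Gamma\{\Box A\}$; from $\Gamma\{\Diamond A,[A,\Delta]\}$ infer $\Gamma\{\Diamond A,[\Delta]\}$. For $n\ge1$, the rule $\Diamond_{\mathsf kn}$ is: from $\Gamma\{\Diamond A,[\Delta_1,[\dots,[\Delta_{n-1},[A,\Delta_n]]\dots]]\}$ infer $\Gamma\{\Diamond A,[\Delta_1,[\dots,[\Delta_{n-1},[\Delta_n]]\dots]]\}$. A sequent is provable in a system if it is the root of a finite tree of nested sequents built from the axioms by the rules of the system. Then for every $X\subseteq\{n\in\mathbb N : n>1\}$ and every formula $A$: if $\mathsf K+\{\Diamond^nB\supset\Diamond B : n\in X,\ B \text{ a formula}\}\vdash A$, then the sequent consisting of $A$ alone is provable, without the cut rule, in $\mathsf{nK}+\{\Diamond_{\mathsf kn} : n\in\hat X\}$. -/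

import Mathlib

universe u

namespace NestedModal

/-! ### Formulas in negation normal form -/

/-- Modal formulas in negation normal form over a set `Atm` of propositional variables. -/
inductive Formula (Atm : Type u) : Type u
  | atom (p : Atm)
  | natom (p : Atm)
  | and (A B : Formula Atm)
  | or (A B : Formula Atm)
  | box (A : Formula Atm)
  | dia (A : Formula Atm)

namespace Formula

variable {Atm : Type u}

/-- The negation of a formula, by de Morgan duality. -/
def neg : Formula Atm → Formula Atm
  | atom p => natom p
  | natom p => atom p
  | and A B => or (neg A) (neg B)
  | or A B => and (neg A) (neg B)
  | box A => dia (neg A)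
  | dia A => box (neg A)

/-- Implication `A ⊃ B`, defined as the disjunction of the negation of `A` with `B`. -/
def imp (A B : Formula Atm) : Formula Atm := or (neg A) B

/-- A Boolean valuation of formulas. Modal formulas are treated as if they were propositional
variables, but `◇` of the negation of `A`, being the negation of `□ A`, gets the opposite value. -/
structure IsValuation (v : Formula Atm → Bool) : Prop where
  and (A B : Formula Atm) : v (Formula.and A B) = (v A && v B)
  or (A B : Formula Atm) : v (Formula.or A B) = (v A || v B)
  neg (A : Formula Atm) : v (Formula.neg A) = !(v A)

/-- Classical propositional tautologies (in the modal language). -/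
def IsTautology (A : Formula Atm) : Prop :=
  ∀ v : Formula Atm → Bool, IsValuation v → v A = true

end Formula

/-! ### The Hilbert system for `K` with additional axioms -/

/-- `KProvable Ax A`: the formula `A` is a theorem of the modal logic `K` extended with all
formulas in `Ax` as axioms. -/
inductive KProvable {Atm : Type u} (Ax : Set (Formula Atm)) : Formula Atm → Prop
  | taut (A : Formula Atm) : A.IsTautology → KProvable Ax A
  | k (A B : Formula Atm) :
      KProvable Ax (((A.imp B).box).imp ((A.box).imp (B.box)))
  | ax (A : Formula Atm) : A ∈ Ax → KProvable Ax A
  | mp (A B : Formula Atm) : KProvable Ax (A.imp B) → KProvable Ax A → KProvable Ax B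
  | nec (A : Formula Atm) : KProvable Ax A → KProvable Ax A.box

/-- All instances of the quasi-transitivity axioms `◇ⁿ A ⊃ ◇ A` with `n ∈ X`. -/
def quasiTransAxioms (Atm : Type u) (X : Set ℕ) : Set (Formula Atm) :=
  {F | ∃ n ∈ X, ∃ A : Formula Atm, F = (Formula.dia^[n] A).imp A.dia}

/-! ### Nested sequents -/

/-- Ordered representatives of nested sequents: finite lists of formulas and boxed sequents. -/
inductive PreSequent (Atm : Type u) : Type u
  | nil
  | formula (A : Formula Atm) (Γ : PreSequent Atm)
  | boxed (Δ Γ : PreSequent Atm)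

namespace PreSequent

variable {Atm : Type u}

/-- Two representatives are equivalent if they differ only in the order of the elements, at any
level of nesting. -/
inductive Equiv : PreSequent Atm → PreSequent Atm → Prop
  | refl (Γ) : Equiv Γ Γ
  | symm {Γ Δ} : Equiv Γ Δ → Equiv Δ Γ
  | trans {Γ Δ Θ} : Equiv Γ Δ → Equiv Δ Θ → Equiv Γ Θ
  | formula (A) {Γ Γ'} : Equiv Γ Γ' → Equiv (formula A Γ) (formula A Γ')
  | boxed {Δ Δ' Γ Γ'} : Equiv Δ Δ' → Equiv Γ Γ' → Equiv (boxed Δ Γ) (boxed Δ' Γ')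
  | swapFF (A B Γ) : Equiv (formula A (formula B Γ)) (formula B (formula A Γ))
  | swapFB (A Δ Γ) : Equiv (formula A (boxed Δ Γ)) (boxed Δ (formula A Γ))
  | swapBB (Δ Θ Γ) : Equiv (boxed Δ (boxed Θ Γ)) (boxed Θ (boxed Δ Γ))

instance setoid (Atm : Type u) : Setoid (PreSequent Atm) where
  r := Equiv
  iseqv := ⟨Equiv.refl, Equiv.symm, Equiv.trans⟩

/-- Concatenation of the outermost lists. -/
def append : PreSequent Atm → PreSequent Atm → PreSequent Atm
  | nil, Δ => Δ
  | formula A Γ, Δ => formula A (append Γ Δ)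
  | boxed Θ Γ, Δ => boxed Θ (append Γ Δ)

theorem append_right (Γ : PreSequent Atm) {Δ Δ' : PreSequent Atm} (h : Equiv Δ Δ') :
    Equiv (append Γ Δ) (append Γ Δ') := by
  induction Γ with
  | nil => exact h
  | formula A Γ ih => exact Equiv.formula A ih
  | boxed Θ Γ _ ih => exact Equiv.boxed (Equiv.refl Θ) ih

theorem append_left {Γ Γ' : PreSequent Atm} (h : Equiv Γ Γ') (Δ : PreSequent Atm) :
    Equiv (append Γ Δ) (append Γ' Δ) := by
  induction h with
  | refl Γ => exact Equiv.refl _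
  | symm _ ih => exact Equiv.symm ih
  | trans _ _ ih₁ ih₂ => exact Equiv.trans ih₁ ih₂
  | formula A _ ih => exact Equiv.formula A ih
  | boxed h _ _ ih => exact Equiv.boxed h ih
  | swapFF A B Γ => exact Equiv.swapFF _ _ _
  | swapFB A Θ Γ => exact Equiv.swapFB _ _ _
  | swapBB Θ Ξ Γ => exact Equiv.swapBB _ _ _

end PreSequent

/-- A nested sequent: a finite multiset of formulas and boxed nested sequents. -/
def Sequent (Atm : Type u) : Type u := Quotient (PreSequent.setoid Atm)

namespace Sequent

variable {Atm : Type u}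

/-- The empty nested sequent. -/
def empty : Sequent Atm := Quotient.mk _ PreSequent.nil

/-- The nested sequent whose only element is the formula `A`. -/
def single (A : Formula Atm) : Sequent Atm := Quotient.mk _ (PreSequent.formula A PreSequent.nil)

/-- The nested sequent whose only element is the boxed sequent `[Δ]`. -/
def bracket : Sequent Atm → Sequent Atm :=
  Quotient.map (fun Δ => PreSequent.boxed Δ PreSequent.nil)
    (fun _ _ h => PreSequent.Equiv.boxed h (PreSequent.Equiv.refl _))

/-- The multiset union `Γ, Δ` of two nested sequents. -/
def union : Sequent Atm → Sequent Atm → Sequent Atm :=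
  Quotient.map₂ PreSequent.append
    (fun _ Γ' h _ _ h' =>
      PreSequent.Equiv.trans (PreSequent.append_left h _) (PreSequent.append_right Γ' h'))

instance : EmptyCollection (Sequent Atm) := ⟨empty⟩

instance : Add (Sequent Atm) := ⟨union⟩

/-- `chain [Δ₁, …, Δₙ] Θ` is the nested sequent `[Δ₁, [Δ₂, […, [Δₙ, Θ] …]]]` when `n ≥ 1`
(and `Θ` itself when `n = 0`). -/
def chain : List (Sequent Atm) → Sequent Atm → Sequent Atm
  | [], Θ => Θ
  | Δ :: Δs, Θ => bracket (Δ + chain Δs Θ)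

end Sequent

/-- Contexts with exactly one hole: `hole Γ` is `Γ, { }` and `boxed Γ C` is `Γ, [C{ }]`. -/
inductive Context (Atm : Type u) : Type u
  | hole (Γ : Sequent Atm)
  | boxed (Γ : Sequent Atm) (C : Context Atm)

/-- The nested sequent obtained by replacing the hole of a context by a nested sequent. -/
def Context.fill {Atm : Type u} : Context Atm → Sequent Atm → Sequent Atm
  | hole Γ, Δ => Γ + Δ
  | boxed Γ C, Δ => Γ + Sequent.bracket (C.fill Δ)

/-! ### Nested sequent systems -/

/-- A nested sequent system, given by the instances of its rules: `N Γs Γ` means that `Γ` follows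
from the list of premisses `Γs` by one rule application. -/
abbrev NestedSystem (Atm : Type u) : Type u := List (Sequent Atm) → Sequent Atm → Prop

/-- `Provable N Γ`: there is a proof of `Γ` in the system `N`, that is, a finite tree of nested
sequents with root `Γ`, each of which follows from its children by a rule of `N`. -/
inductive Provable {Atm : Type u} (N : NestedSystem Atm) : Sequent Atm → Prop
  | rule (Γs : List (Sequent Atm)) (Γ : Sequent Atm) :
      N Γs Γ → (∀ Δ ∈ Γs, Provable N Δ) → Provable N Γ

open Sequent Formula in
/-- The rules of the (cut-free) nested sequent system `nK`. -/
inductive nK {Atm : Type u} : List (Sequent Atm) → Sequent Atm → Prop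
  | id (C : Context Atm) (p : Atm) :
      nK [] (C.fill (single (atom p) + single (natom p)))
  | or (C : Context Atm) (A B : Formula Atm) :
      nK [C.fill (single A + single B)] (C.fill (single (Formula.or A B)))
  | and (C : Context Atm) (A B : Formula Atm) :
      nK [C.fill (single A), C.fill (single B)] (C.fill (single (Formula.and A B)))
  | box (C : Context Atm) (A : Formula Atm) :
      nK [C.fill (bracket (single A))] (C.fill (single (Formula.box A)))
  | dia (C : Context Atm) (A : Formula Atm) (Δ : Sequent Atm) :
      nK [C.fill (single (Formula.dia A) + bracket (single A + Δ))]
        (C.fill (single (Formula.dia A) + bracket Δ))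

open Sequent Formula in
/-- The modal propagation rule `◇ₖₙ` for `n ≥ 1`: from `Γ{◇A, [Δ₁, […, [Δₙ, A] …]]}` infer
`Γ{◇A, [Δ₁, […, [Δₙ] …]]}`. -/
inductive diaK {Atm : Type u} (n : ℕ) : List (Sequent Atm) → Sequent Atm → Prop
  | mk (hn : 1 ≤ n) (C : Context Atm) (A : Formula Atm) (Δs : List (Sequent Atm))
      (hlen : Δs.length = n) :
      diaK n [C.fill (single (dia A) + chain Δs (single A))]
        (C.fill (single (dia A) + chain Δs ∅))

/-- The set of rules `◇ₖₙ` with `n ∈ X`. -/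
def diaKRules {Atm : Type u} (X : Set ℕ) : NestedSystem Atm :=
  fun Γs Γ => ∃ n ∈ X, diaK n Γs Γ

/-- The system whose rules are those of `N` together with those of `M`. -/
def NestedSystem.plus {Atm : Type u} (N M : NestedSystem Atm) : NestedSystem Atm :=
  fun Γs Γ => N Γs Γ ∨ M Γs Γ

/-! ### Completion -/

/-- The stages `X₀ = X` and `Xₚ₊₁ = Xₚ ∪ {m + n - 1 : m, n ∈ Xₚ}` of the completion of `X`. -/
def completionStage (X : Set ℕ) : ℕ → Set ℕ
  | 0 => X
  | p + 1 => completionStage X p ∪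
      {k | ∃ m ∈ completionStage X p, ∃ n ∈ completionStage X p, k = m + n - 1}

/-- The completion of `X`, the union of its stages. -/
def completion (X : Set ℕ) : Set ℕ := ⋃ p : ℕ, completionStage X p

end NestedModal

/-! The proof is semantic: completeness of the cut-free calculus for suitable tree models replaces
cut elimination. If the sequent `A` is unprovable, then `A` placed at the root extends to a maximal
consistent set `S` of formulas labelled by nodes of a tree. Such an `S` is saturated
(`isSaturated_of_maximal`), and the tree in which `w` sees its descendants in `S` at distance `1` or
at a distance in `X̂` falsifies every formula of `S` (`IsSaturated.not_sat`), in particular `A`.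

On the other side, these models validate the axioms. A path of `n ∈ X` steps, each of length `1` or
of some length `k ∈ X̂`, has total length `n` plus the sum of the excesses `k - 1`. This number
arises from `n` by repeated use of `(m, k) ↦ m + k - 1`, hence lies in `X̂`, and one step does the
work of `n` (`sat_of_mem_quasiTransAxioms`). So a theorem of the Hilbert system holds in all of
them, and its sequent must be provable.

The delicate point is the notion of consistency. The rules for `∧`, `∨` and `□` consume their
principal formula, while `S` only accumulates, and neither weakening nor contraction is available as
a rule. Therefore a finite set `T` counts as refuted when every finite labelled tree into which it
maps is provable, and a mapping only asks a node to cover a formula: to contain it, or enough of the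
parts to which the rules reduce it. Larger trees are allowed as targets, which takes the place of
weakening; covering takes the place of contraction. Each rule becomes a closure property of
`Refutes`, and these properties are exactly what saturation needs. -/

namespace NestedModal

variable {Atm : Type u}

/-! ### Nested sequents as a commutative monoid -/

namespace PreSequent

theorem append_nil (Γ : PreSequent Atm) : append Γ nil = Γ := by
  induction Γ with
  | nil => rfl
  | formula A Γ ih => simp [append, ih]
  | boxed Θ Γ _ ih => simp [append, ih]

theorem append_assoc (Γ Δ Θ : PreSequent Atm) :
    append (append Γ Δ) Θ = append Γ (append Δ Θ) := by
  induction Γ with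
  | nil => rfl
  | formula A Γ ih => simp [append, ih]
  | boxed Ξ Γ _ ih => simp [append, ih]

theorem append_formula (A : Formula Atm) (Γ Δ : PreSequent Atm) :
    Equiv (append Γ (formula A Δ)) (formula A (append Γ Δ)) := by
  induction Γ with
  | nil => exact Equiv.refl _
  | formula B Γ ih => exact (Equiv.formula B ih).trans (Equiv.swapFF _ _ _)
  | boxed Θ Γ _ ih => exact (Equiv.boxed (Equiv.refl Θ) ih).trans (Equiv.swapFB _ _ _).symm

theorem append_boxed (Ξ Γ Δ : PreSequent Atm) :
    Equiv (append Γ (boxed Ξ Δ)) (boxed Ξ (append Γ Δ)) := by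
  induction Γ with
  | nil => exact Equiv.refl _
  | formula B Γ ih => exact (Equiv.formula B ih).trans (Equiv.swapFB _ _ _)
  | boxed Θ Γ _ ih => exact (Equiv.boxed (Equiv.refl Θ) ih).trans (Equiv.swapBB _ _ _)

theorem append_comm (Γ Δ : PreSequent Atm) : Equiv (append Γ Δ) (append Δ Γ) := by
  induction Γ with
  | nil => rw [append_nil]; exact Equiv.refl _
  | formula B Γ ih => exact (Equiv.formula B ih).trans (append_formula _ _ _).symm
  | boxed Θ Γ _ ih => exact (Equiv.boxed (Equiv.refl Θ) ih).trans (append_boxed _ _ _).symm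

end PreSequent

namespace Sequent

instance : Zero (Sequent Atm) := ⟨∅⟩

instance : AddCommMonoid (Sequent Atm) where
  add_assoc := by
    rintro ⟨Γ⟩ ⟨Δ⟩ ⟨Θ⟩
    exact congrArg (Quotient.mk _) (PreSequent.append_assoc Γ Δ Θ)
  zero_add := by
    rintro ⟨Γ⟩
    rfl
  add_zero := by
    rintro ⟨Γ⟩
    exact congrArg (Quotient.mk _) (PreSequent.append_nil Γ)
  add_comm := by
    rintro ⟨Γ⟩ ⟨Δ⟩
    exact Quotient.sound (PreSequent.append_comm Γ Δ)
  nsmul := nsmulRec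

theorem empty_eq_zero : (∅ : Sequent Atm) = 0 := rfl

/-- The nested sequent consisting of the formulas of a multiset. -/
def ofMultiset (M : Multiset (Formula Atm)) : Sequent Atm := (M.map single).sum

@[simp] theorem ofMultiset_zero : ofMultiset (0 : Multiset (Formula Atm)) = 0 := by
  simp [ofMultiset]

@[simp] theorem ofMultiset_cons (A : Formula Atm) (M : Multiset (Formula Atm)) :
    ofMultiset (A ::ₘ M) = single A + ofMultiset M := by
  simp [ofMultiset]

@[simp] theorem ofMultiset_add (M N : Multiset (Formula Atm)) :
    ofMultiset (M + N) = ofMultiset M + ofMultiset N := by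
  simp [ofMultiset]

@[simp] theorem ofMultiset_singleton (A : Formula Atm) :
    ofMultiset ({A} : Multiset (Formula Atm)) = single A := by
  simp [ofMultiset]

end Sequent

namespace Context

/-- The context with `Δ` put beside the hole. -/
def extend : Context Atm → Sequent Atm → Context Atm
  | hole Γ, Δ => hole (Γ + Δ)
  | boxed Γ C, Δ => boxed Γ (C.extend Δ)

theorem fill_extend (C : Context Atm) (Δ Θ : Sequent Atm) :
    (C.extend Δ).fill Θ = C.fill (Δ + Θ) := by
  induction C with
  | hole Γ => simp [extend, fill, add_assoc]
  | boxed Γ C ih => simp [extend, fill, ih]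

/-- The context with its hole moved into a new box. -/
def deepen : Context Atm → Context Atm
  | hole Γ => boxed Γ (hole 0)
  | boxed Γ C => boxed Γ C.deepen

theorem fill_deepen (C : Context Atm) (Θ : Sequent Atm) :
    C.deepen.fill Θ = C.fill (Sequent.bracket Θ) := by
  induction C with
  | hole Γ => simp [deepen, fill]
  | boxed Γ C ih => simp [deepen, fill, ih]

end Context

/-! ### Labelled trees -/

/-- The sequent at the node `w` of a labelled tree, cut off `d` levels above `w`. A node is
the list of the names of the branches that lead to it, the last one first. -/
def seqAt (lab : List ℕ → Multiset (Formula Atm)) (ch : List ℕ → Finset ℕ) :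
    ℕ → List ℕ → Sequent Atm
  | 0, w => Sequent.ofMultiset (lab w)
  | d + 1, w => Sequent.ofMultiset (lab w) + ∑ i ∈ ch w, Sequent.bracket (seqAt lab ch d (i :: w))

/-- `w` is a node of the tree with branches `ch`. -/
def IsNode (ch : List ℕ → Finset ℕ) : List ℕ → Prop
  | [] => True
  | i :: w => i ∈ ch w ∧ IsNode ch w

theorem seqAt_congr {lab lab' : List ℕ → Multiset (Formula Atm)} {ch ch' : List ℕ → Finset ℕ}
    (d : ℕ) (w : List ℕ) (h : ∀ u, w <:+ u → lab u = lab' u ∧ ch u = ch' u) :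
    seqAt lab ch d w = seqAt lab' ch' d w := by
  induction d generalizing w with
  | zero => simp [seqAt, (h w List.suffix_rfl).1]
  | succ d ih =>
    rw [seqAt, seqAt, (h w List.suffix_rfl).1, (h w List.suffix_rfl).2]
    congr 1
    refine Finset.sum_congr rfl fun i _ => ?_
    rw [ih (i :: w) fun u hu => h u ((List.suffix_cons i w).trans hu)]

theorem seqAt_succ_eq {lab : List ℕ → Multiset (Formula Atm)} {ch : List ℕ → Finset ℕ}
    (d : ℕ) (w : List ℕ) (h : ∀ u : List ℕ, w.length + d ≤ u.length → ch u = ∅) :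
    seqAt lab ch (d + 1) w = seqAt lab ch d w := by
  induction d generalizing w with
  | zero => simp [seqAt, h w (by simp)]
  | succ d ih =>
    rw [seqAt, seqAt]
    congr 1
    refine Finset.sum_congr rfl fun i _ => ?_
    rw [ih (i :: w) fun u hu => h u (by simp at hu; omega)]

theorem eq_of_cons_suffix {α : Type*} {i j : α} {w u : List α} (hi : (i :: w) <:+ u)
    (hj : (j :: w) <:+ u) : i = j := by
  have := (List.suffix_of_suffix_length_le hi hj (by simp)).eq_of_length (by simp)
  simpa using this

/-- The context is read off from the part of the tree outside the subtree at `w`. Hence one `C`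
serves all trees that agree there, and premiss and conclusion of a rule share it. -/
theorem exists_context_seqAt (lab : List ℕ → Multiset (Formula Atm)) (ch : List ℕ → Finset ℕ)
    (d : ℕ) (w : List ℕ) (hw : IsNode ch w) (hd : w.length ≤ d) :
    ∃ C : Context Atm, ∀ lab' ch', (∀ u, ¬ w <:+ u → lab' u = lab u ∧ ch' u = ch u) →
      seqAt lab' ch' d [] = C.fill (seqAt lab' ch' (d - w.length) w) := by
  induction w with
  | nil => exact ⟨.hole 0, fun lab' ch' _ => by simp [Context.fill]⟩
  | cons i w ih =>
    obtain ⟨C, hC⟩ := ih hw.2 (by simp at hd; omega)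
    obtain ⟨e, he⟩ : ∃ e, d - w.length = e + 1 :=
      ⟨d - w.length - 1, by simp at hd; omega⟩
    have he' : d - (i :: w).length = e := by simp; omega
    refine ⟨(C.extend (Sequent.ofMultiset (lab w) +
      ∑ j ∈ (ch w).erase i, Sequent.bracket (seqAt lab ch e (j :: w)))).deepen,
      fun lab' ch' h => ?_⟩
    have hww : ¬ (i :: w) <:+ w := fun h => by simpa using h.length_le
    rw [hC lab' ch' fun u hu => h u fun hu' => hu ((List.suffix_cons i w).trans hu'),
      Context.fill_deepen, Context.fill_extend, he, he', seqAt, (h w hww).1, (h w hww).2,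
      ← Finset.sum_erase_add _ _ hw.1, add_assoc]
    congr 3
    refine Finset.sum_congr rfl fun j hj => ?_
    rw [seqAt_congr e (j :: w) fun u hu => h u fun hu' =>
      (Finset.mem_erase.1 hj).1 (eq_of_cons_suffix hu hu')]

theorem exists_chain_seqAt (lab : List ℕ → Multiset (Formula Atm)) (ch : List ℕ → Finset ℕ)
    (l : List ℕ) (w : List ℕ) (d : ℕ) (hw : IsNode ch (l ++ w)) (hd : l.length ≤ d) :
    ∃ (Γ : Sequent Atm) (Δs : List (Sequent Atm)), Δs.length = l.length ∧
      (l ≠ [] → ∃ Θ, Γ = Sequent.ofMultiset (lab w) + Θ) ∧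
      ∀ M, seqAt (Function.update lab (l ++ w) (lab (l ++ w) + M)) ch d w =
        Γ + Sequent.chain Δs (Sequent.ofMultiset M) := by
  -- The last entry of `l` is the branch taken first from `w`, so the outermost bracket of the chain
  -- is peeled off at the end of the list.
  induction l using List.reverseRecOn generalizing w d with
  | nil =>
    cases d with
    | zero =>
      exact ⟨Sequent.ofMultiset (lab w), [], rfl, by simp, fun M => by
        simp [seqAt, Sequent.chain]⟩
    | succ d =>
      refine ⟨Sequent.ofMultiset (lab w) +
        ∑ i ∈ ch w, Sequent.bracket (seqAt lab ch d (i :: w)), [], rfl, by simp, fun M => ?_⟩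
      simp only [seqAt, Sequent.chain, List.nil_append, Function.update_self,
        Sequent.ofMultiset_add]
      rw [add_right_comm]
      congr 2
      refine Finset.sum_congr rfl fun i _ => ?_
      have hne : ∀ u, (i :: w) <:+ u → u ≠ w := by
        rintro u hu rfl
        simpa using hu.length_le
      rw [seqAt_congr d (i :: w) fun u hu => ⟨Function.update_of_ne (hne u hu) _ _, rfl⟩]
  | append_singleton l i ih =>
    have hl : l ++ [i] ++ w = l ++ i :: w := by simp
    rw [hl] at hw ⊢
    obtain ⟨e, rfl⟩ : ∃ e, d = e + 1 := ⟨d - 1, by simp at hd; omega⟩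
    obtain ⟨Γ, Δs, hlen, -, h⟩ := ih (i :: w) e hw (by simpa using hd)
    have hi : i ∈ ch w := by
      clear h hd ih hl hlen
      induction l with
      | nil => exact hw.1
      | cons _ l ih => exact ih hw.2
    refine ⟨Sequent.ofMultiset (lab w) +
      ∑ j ∈ (ch w).erase i, Sequent.bracket (seqAt lab ch e (j :: w)), Γ :: Δs, by simp [hlen],
      fun _ => ⟨_, rfl⟩, fun M => ?_⟩
    have hne : w ≠ l ++ i :: w := fun h => by
      have := congrArg List.length h
      simp at this
      omega
    rw [seqAt, Function.update_of_ne hne, ← Finset.sum_erase_add _ _ hi, h, Sequent.chain,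
      add_assoc]
    congr 2
    refine Finset.sum_congr rfl fun j hj => ?_
    have hne' : ∀ u, (j :: w) <:+ u → u ≠ l ++ i :: w := by
      rintro u hu rfl
      exact (Finset.mem_erase.1 hj).1 (eq_of_cons_suffix hu (List.suffix_append _ _))
    rw [seqAt_congr e (j :: w) fun u hu => ⟨Function.update_of_ne (hne' u hu) _ _, rfl⟩]

/-- A finite tree whose nodes are labelled with finite multisets of formulas. -/
structure LTree (Atm : Type u) where
  /-- The formulas at a node. -/
  label : List ℕ → Multiset (Formula Atm)
  /-- The names of the branches at a node. -/
  children : List ℕ → Finset ℕ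
  /-- A bound on the depth of the tree. -/
  depth : ℕ
  isNode_of_label : ∀ w, label w ≠ 0 → IsNode children w
  isNode_of_children : ∀ w, children w ≠ ∅ → IsNode children w
  children_eq_empty : ∀ w : List ℕ, depth ≤ w.length → children w = ∅

namespace LTree

/-- The nested sequent denoted by a labelled tree. -/
def toSequent (Θ : LTree Atm) : Sequent Atm := seqAt Θ.label Θ.children Θ.depth []

theorem length_le_depth (Θ : LTree Atm) {w : List ℕ} (hw : IsNode Θ.children w) :
    w.length ≤ Θ.depth := by
  cases w with
  | nil => simp
  | cons i w =>
    by_contra h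
    have := Θ.children_eq_empty w (by simp at h; omega)
    exact absurd hw.1 (by simp [this])

theorem isNode_of_mem (Θ : LTree Atm) {w : List ℕ} {A : Formula Atm} (h : A ∈ Θ.label w) :
    IsNode Θ.children w :=
  Θ.isNode_of_label w fun h0 => by simp [h0] at h

/-- Replace the label of a node. -/
def setLabel (Θ : LTree Atm) (w : List ℕ) (hw : IsNode Θ.children w)
    (M : Multiset (Formula Atm)) : LTree Atm where
  label := Function.update Θ.label w M
  children := Θ.children
  depth := Θ.depth
  isNode_of_label u hu := by
    by_cases h : u = w
    · exact h ▸ hw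
    · exact Θ.isNode_of_label u (by rwa [Function.update_of_ne h] at hu)
  isNode_of_children := Θ.isNode_of_children
  children_eq_empty := Θ.children_eq_empty

theorem exists_context_setLabel (Θ : LTree Atm) (w : List ℕ) (hw : IsNode Θ.children w) :
    ∃ C : Context Atm, Θ.toSequent = C.fill (Sequent.ofMultiset (Θ.label w)) ∧
      ∀ M, (Θ.setLabel w hw M).toSequent = C.fill (Sequent.ofMultiset M) := by
  obtain ⟨C, hC⟩ := exists_context_seqAt Θ.label Θ.children Θ.depth w hw (Θ.length_le_depth hw)
  -- With the label of `w` emptied beforehand, adding `M` there amounts to replacing the label by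
  -- `M`.
  obtain ⟨Γ, Δs, hlen, -, h⟩ := exists_chain_seqAt (Function.update Θ.label w 0) Θ.children [] w
    (Θ.depth - w.length) hw (by simp)
  obtain rfl : Δs = [] := by simpa using hlen
  have key : ∀ M, (Θ.setLabel w hw M).toSequent =
      (C.extend Γ).fill (Sequent.ofMultiset M) := fun M => by
    have := h M
    simp only [List.nil_append, Function.update_self, zero_add, Function.update_idem,
      Sequent.chain] at this
    rw [Context.fill_extend, ← this]
    refine hC _ _ fun u hu => ⟨Function.update_of_ne ?_ _ _, rfl⟩
    rintro rfl
    exact hu List.suffix_rfl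
  refine ⟨_, ?_, key⟩
  rw [← key]
  simp [toSequent, setLabel]

theorem exists_chain_setLabel (Θ : LTree Atm) (A B : Formula Atm) (w l : List ℕ) (hl : l ≠ [])
    (hA : A ∈ Θ.label w) (hw : IsNode Θ.children (l ++ w)) :
    ∃ (C : Context Atm) (Δs : List (Sequent Atm)), Δs.length = l.length ∧
      Θ.toSequent = C.fill (Sequent.single A + Sequent.chain Δs ∅) ∧
      (Θ.setLabel _ hw (B ::ₘ Θ.label (l ++ w))).toSequent =
        C.fill (Sequent.single A + Sequent.chain Δs (Sequent.single B)) := by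
  have hw' := Θ.isNode_of_mem hA
  obtain ⟨C, hC⟩ := exists_context_seqAt Θ.label Θ.children Θ.depth w hw' (Θ.length_le_depth hw')
  have hlen := Θ.length_le_depth hw
  obtain ⟨Γ, Δs, hΔs, hΓ, h⟩ := exists_chain_seqAt Θ.label Θ.children l w
    (Θ.depth - w.length) hw (by simp at hlen; omega)
  obtain ⟨Ξ, rfl⟩ := hΓ hl
  obtain ⟨M₀, hM₀⟩ := Multiset.exists_cons_of_mem hA
  have key : ∀ M, seqAt (Function.update Θ.label (l ++ w) (Θ.label (l ++ w) + M)) Θ.children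
      Θ.depth [] = (C.extend (Sequent.ofMultiset M₀ + Ξ)).fill
        (Sequent.single A + Sequent.chain Δs (Sequent.ofMultiset M)) := fun M => by
    have hu : ∀ u, ¬ w <:+ u → u ≠ l ++ w := by
      rintro u hu rfl
      exact hu (List.suffix_append _ _)
    rw [hC _ _ fun u h' => ⟨Function.update_of_ne (hu u h') _ _, rfl⟩, h M, Context.fill_extend,
      hM₀, Sequent.ofMultiset_cons]
    congr 1
    abel
  refine ⟨C.extend (Sequent.ofMultiset M₀ + Ξ), Δs, hΔs, ?_, ?_⟩
  · have := key 0
    simpa [toSequent, Sequent.empty_eq_zero] using this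
  · have := key {B}
    rw [add_comm, Multiset.singleton_add] at this
    simpa [toSequent, setLabel] using this

theorem isNode_mono {ch ch' : List ℕ → Finset ℕ} (h : ∀ u, ch u ⊆ ch' u) {w : List ℕ}
    (hw : IsNode ch w) : IsNode ch' w := by
  induction w with
  | nil => trivial
  | cons i w ih => exact ⟨h _ hw.1, ih hw.2⟩

theorem subset_update_insert (ch : List ℕ → Finset ℕ) (w : List ℕ) (i : ℕ) (u : List ℕ) :
    ch u ⊆ Function.update ch w (insert i (ch w)) u := by
  by_cases h : u = w
  · subst h
    simp
  · rw [Function.update_of_ne h]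

/-- Replace the label of the node `w` and add a branch with name `i` that leads to a leaf. -/
def addChild (Θ : LTree Atm) (w : List ℕ) (hw : IsNode Θ.children w)
    (M : Multiset (Formula Atm)) (i : ℕ) (A : Formula Atm) : LTree Atm where
  label := Function.update (Function.update Θ.label w M) (i :: w) {A}
  children := Function.update Θ.children w (insert i (Θ.children w))
  depth := Θ.depth + 1
  isNode_of_label u hu := by
    have mono := @isNode_mono _ _ (subset_update_insert Θ.children w i)
    by_cases h : u = i :: w
    · subst h
      exact ⟨by simp, mono hw⟩
    · rw [Function.update_of_ne h] at hu
      by_cases h' : u = w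
      · exact h' ▸ mono hw
      · exact mono (Θ.isNode_of_label u (by rwa [Function.update_of_ne h'] at hu))
  isNode_of_children u hu := by
    have mono := @isNode_mono _ _ (subset_update_insert Θ.children w i)
    by_cases h : u = w
    · exact h ▸ mono hw
    · exact mono (Θ.isNode_of_children u (by rwa [Function.update_of_ne h] at hu))
  children_eq_empty u hu := by
    have := Θ.length_le_depth hw
    rw [Function.update_of_ne, Θ.children_eq_empty u (by omega)]
    rintro rfl
    omega

theorem exists_context_addChild (Θ : LTree Atm) (w : List ℕ) (hw : IsNode Θ.children w)
    (B : Formula Atm) (M : Multiset (Formula Atm)) (hM : Θ.label w = B ::ₘ M) (i : ℕ)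
    (hi : i ∉ Θ.children w) (A : Formula Atm) :
    ∃ C : Context Atm, Θ.toSequent = C.fill (Sequent.single B) ∧
      (Θ.addChild w hw M i A).toSequent = C.fill (Sequent.bracket (Sequent.single A)) := by
  have hd := Θ.length_le_depth hw
  obtain ⟨C, hC⟩ := exists_context_seqAt Θ.label Θ.children (Θ.depth + 1) w hw (by omega)
  obtain ⟨e, he⟩ : ∃ e, Θ.depth + 1 - w.length = e + 1 :=
    ⟨Θ.depth - w.length, by omega⟩
  refine ⟨C.extend (Sequent.ofMultiset M +
    ∑ j ∈ Θ.children w, Sequent.bracket (seqAt Θ.label Θ.children e (j :: w))), ?_, ?_⟩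
  -- The old tree is read one level deeper, which changes nothing, so that both trees have the same
  -- cut-off.
  · rw [toSequent, ← seqAt_succ_eq _ _ fun u hu => Θ.children_eq_empty u (by simpa using hu),
      hC _ _ fun _ _ => ⟨rfl, rfl⟩, he, seqAt, hM, Sequent.ofMultiset_cons, Context.fill_extend]
    congr 1
    abel
  · have hne : w ≠ i :: w := by simp
    have hiw : Θ.children (i :: w) = ∅ := by
      by_contra h
      exact hi (Θ.isNode_of_children _ h).1
    rw [Context.fill_extend, toSequent, show (Θ.addChild w hw M i A).depth = Θ.depth + 1 from rfl,
      hC, he, seqAt]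
    · simp only [addChild]
      rw [Function.update_of_ne hne, Function.update_self, Function.update_self,
        Finset.sum_insert hi]
      have h₁ : seqAt (Function.update (Function.update Θ.label w M) (i :: w) {A})
          (Function.update Θ.children w (insert i (Θ.children w))) e (i :: w) =
            Sequent.single A := by
        cases e <;> simp [seqAt, hiw]
      rw [h₁, add_comm (Sequent.bracket _), ← add_assoc]
      congr 3
      refine Finset.sum_congr rfl fun j hj => ?_
      have h₂ : ∀ u, (j :: w) <:+ u → u ≠ w := by
        rintro u hu rfl
        simpa using hu.length_le
      have h₃ : ∀ u, (j :: w) <:+ u → u ≠ i :: w := by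
        rintro u hu rfl
        exact hi (eq_of_cons_suffix hu List.suffix_rfl ▸ hj)
      rw [seqAt_congr e (j :: w) fun u hu => ⟨by
        rw [Function.update_of_ne (h₃ u hu), Function.update_of_ne (h₂ u hu)],
        Function.update_of_ne (h₂ u hu) _ _⟩]
    · intro u hu
      have h₁ : u ≠ w := by
        rintro rfl
        exact hu List.suffix_rfl
      have h₂ : u ≠ i :: w := by
        rintro rfl
        exact hu (List.suffix_cons _ _)
      simp [addChild, Function.update_of_ne h₁, Function.update_of_ne h₂]

/-- `Θ.Covers w A`: the formula `A`, or enough of its parts, occurs at the node `w` of `Θ`. -/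
def Covers (Θ : LTree Atm) : List ℕ → Formula Atm → Prop
  | w, .atom p => .atom p ∈ Θ.label w
  | w, .natom p => .natom p ∈ Θ.label w
  | w, .and A B => .and A B ∈ Θ.label w ∨ Θ.Covers w A ∨ Θ.Covers w B
  | w, .or A B => .or A B ∈ Θ.label w ∨ Θ.Covers w A ∧ Θ.Covers w B
  | w, .box A => .box A ∈ Θ.label w ∨ ∃ i ∈ Θ.children w, Θ.Covers (i :: w) A
  | w, .dia A => .dia A ∈ Θ.label w

theorem covers_of_mem {Θ : LTree Atm} {w : List ℕ} {A : Formula Atm} (h : A ∈ Θ.label w) :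
    Θ.Covers w A := by
  cases A <;> simp [Covers, h]

/-- A rule read upwards may remove a formula, provided that what replaces it covers it. The
hypothesis on labels therefore asks for covering in `Θ'`, not for membership. -/
theorem Covers.mono {Θ Θ' : LTree Atm} (hl : ∀ u, ∀ A ∈ Θ.label u, Θ'.Covers u A)
    (hc : ∀ u, Θ.children u ⊆ Θ'.children u) {w : List ℕ} {A : Formula Atm}
    (h : Θ.Covers w A) : Θ'.Covers w A := by
  induction A generalizing w with
  | atom p => exact hl w _ h
  | natom p => exact hl w _ h
  | and A B ihA ihB =>
    obtain h | h | h := h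
    · exact hl w _ h
    · exact .inr (.inl (ihA h))
    · exact .inr (.inr (ihB h))
  | or A B ihA ihB =>
    obtain h | ⟨h, h'⟩ := h
    · exact hl w _ h
    · exact .inr ⟨ihA h, ihB h'⟩
  | box A ih =>
    obtain h | ⟨i, hi, h⟩ := h
    · exact hl w _ h
    · exact .inr ⟨i, hc w hi, ih h⟩
  | dia A => exact hl w _ h

theorem Covers.setLabel {Θ : LTree Atm} {v : List ℕ} {hv : IsNode Θ.children v}
    {M : Multiset (Formula Atm)} (hM : ∀ A ∈ Θ.label v, (Θ.setLabel v hv M).Covers v A)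
    {w : List ℕ} {A : Formula Atm} (h : Θ.Covers w A) : (Θ.setLabel v hv M).Covers w A := by
  refine Covers.mono (Θ := Θ) (Θ' := Θ.setLabel v hv M) (fun u B hB => ?_) (fun _ => Finset.Subset.refl _) h
  by_cases hu : u = v
  · subst hu
    exact hM B hB
  · refine covers_of_mem ?_
    simpa [LTree.setLabel, Function.update_of_ne hu] using hB

end LTree

/-! ### The completion -/

theorem completionStage_mono (X : Set ℕ) {p q : ℕ} (h : p ≤ q) :
    completionStage X p ⊆ completionStage X q := by
  induction h with
  | refl => exact subset_rfl
  | step _ ih => exact ih.trans Set.subset_union_left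

theorem subset_completion (X : Set ℕ) : X ⊆ completion X :=
  Set.subset_iUnion (completionStage X) 0

theorem completion_add_sub_one {X : Set ℕ} {m n : ℕ} (hm : m ∈ completion X)
    (hn : n ∈ completion X) : m + n - 1 ∈ completion X := by
  obtain ⟨p, hp⟩ := Set.mem_iUnion.1 hm
  obtain ⟨q, hq⟩ := Set.mem_iUnion.1 hn
  exact Set.mem_iUnion.2 ⟨max p q + 1, .inr ⟨m, completionStage_mono X (le_max_left p q) hp, n,
    completionStage_mono X (le_max_right p q) hq, rfl⟩⟩

theorem one_lt_of_mem_completion {X : Set ℕ} (hX : X ⊆ {n : ℕ | 1 < n}) {n : ℕ}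
    (hn : n ∈ completion X) : 1 < n := by
  obtain ⟨p, hp⟩ := Set.mem_iUnion.1 hn
  induction p generalizing n with
  | zero => exact hX hp
  | succ p ih =>
    obtain hp | ⟨k, hk, m, hm, rfl⟩ := hp
    · exact ih hn hp
    · have := ih (Set.mem_iUnion.2 ⟨p, hk⟩) hk
      have := ih (Set.mem_iUnion.2 ⟨p, hm⟩) hm
      omega

/-! ### Kripke semantics -/

/-- Satisfaction of a formula at a world of a Kripke model. -/
def Sat {W : Type*} (R : W → W → Prop) (V : W → Atm → Prop) : W → Formula Atm → Prop
  | w, .atom p => V w p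
  | w, .natom p => ¬ V w p
  | w, .and A B => Sat R V w A ∧ Sat R V w B
  | w, .or A B => Sat R V w A ∨ Sat R V w B
  | w, .box A => ∀ v, R w v → Sat R V v A
  | w, .dia A => ∃ v, R w v ∧ Sat R V v A

section Soundness

variable {W : Type*} {R : W → W → Prop} {V : W → Atm → Prop}

theorem sat_neg (w : W) (A : Formula Atm) : Sat R V w A.neg ↔ ¬ Sat R V w A := by
  induction A generalizing w with
  | atom p => rfl
  | natom p => simp [Formula.neg, Sat]
  | and A B ihA ihB => simp [Formula.neg, Sat, ihA, ihB, imp_iff_not_or]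
  | or A B ihA ihB => simp [Formula.neg, Sat, ihA, ihB]
  | box A ih => simp [Formula.neg, Sat, ih]
  | dia A ih => simp [Formula.neg, Sat, ih]

theorem sat_imp (w : W) (A B : Formula Atm) :
    Sat R V w (A.imp B) ↔ (Sat R V w A → Sat R V w B) := by
  simp [Formula.imp, Sat, sat_neg, imp_iff_not_or]

open Classical in
theorem sat_of_isTautology {A : Formula Atm} (h : A.IsTautology) (w : W) : Sat R V w A := by
  have := h (fun B => decide (Sat R V w B))
    ⟨fun A B => Bool.eq_iff_iff.2 (by
        simp only [decide_eq_true_eq, Bool.and_eq_true]; exact Iff.rfl),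
      fun A B => Bool.eq_iff_iff.2 (by
        simp only [decide_eq_true_eq, Bool.or_eq_true]; exact Iff.rfl),
      fun A => by simp [sat_neg]⟩
  simpa using this

theorem sat_of_kProvable {Ax : Set (Formula Atm)} (hAx : ∀ A ∈ Ax, ∀ w, Sat R V w A)
    {A : Formula Atm} (h : KProvable Ax A) (w : W) : Sat R V w A := by
  induction h generalizing w with
  | taut A h => exact sat_of_isTautology h w
  | k A B =>
    rw [sat_imp, sat_imp]
    exact fun h₁ h₂ v hv => (sat_imp v A B).1 (h₁ v hv) (h₂ v hv)
  | ax A h => exact hAx A h w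
  | mp A B _ _ ih₁ ih₂ => exact (sat_imp w A B).1 (ih₁ w) (ih₂ w)
  | nec A _ ih => exact fun v _ => ih v

end Soundness

/-! ### The tree model of a set of labelled formulas -/

/-- Sets of formulas labelled by the nodes of a tree in which a branch is named by the formula
whose box has created it. -/
abbrev LabelledSet (Atm : Type u) : Type u := Set (List (Formula Atm) × Formula Atm)

/-- `v` occurs in `S` as a descendant of `w`, by a number of steps that is `1` or in `Y`. -/
def TreeRel (Y : Set ℕ) (S : LabelledSet Atm) (w v : List (Formula Atm)) : Prop :=
  (∃ A, (v, A) ∈ S) ∧ ∃ l, v = l ++ w ∧ (l.length = 1 ∨ l.length ∈ Y)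

/-- Here `s` is the sum of the excesses `k - 1` over the steps of the path. It need not lie in the
completion itself; what survives the induction is that adding `s` preserves membership. Only the end
of the path has to occur in `S`, as `TreeRel` ignores intermediate nodes. -/
theorem exists_append_of_sat_dia_iterate {X : Set ℕ} (hX : X ⊆ {n : ℕ | 1 < n})
    {S : LabelledSet Atm} {V : List (Formula Atm) → Atm → Prop} {A : Formula Atm} (n : ℕ)
    (w : List (Formula Atm)) (h : Sat (TreeRel (completion X) S) V w (Formula.dia^[n] A)) :
    ∃ (l : List (Formula Atm)) (s : ℕ), Sat (TreeRel (completion X) S) V (l ++ w) A ∧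
      l.length = n + s ∧ (∀ m ∈ completion X, m + s ∈ completion X) ∧
      (n = 0 → l = []) ∧ (0 < n → ∃ B, (l ++ w, B) ∈ S) := by
  induction n generalizing w with
  | zero => exact ⟨[], 0, h, rfl, fun m hm => hm, by simp, by simp⟩
  | succ n ih =>
    rw [Function.iterate_succ_apply'] at h
    obtain ⟨v, ⟨hv, k, rfl, hk⟩, h⟩ := h
    obtain ⟨l, s, hA, hl, hs, h0, hn⟩ := ih _ h
    have hnode : ∃ B, (l ++ (k ++ w), B) ∈ S := by
      rcases Nat.eq_zero_or_pos n with rfl | hn'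
      · simpa [h0 rfl] using hv
      · exact hn hn'
    refine ⟨l ++ k, s + (k.length - 1), by simpa using hA, ?_, fun m hm => ?_,
      by simp, fun _ => by simpa using hnode⟩
    · have : 1 ≤ k.length := by
        rcases hk with hk | hk
        · omega
        · exact (one_lt_of_mem_completion hX hk).le
      simp
      omega
    · rcases hk with hk | hk
      · simpa [hk] using hs m hm
      -- A step of length `k` turns `m + s` into `m + s + k - 1`, one application of the completion.
      · have := completion_add_sub_one (hs m hm) hk
        have h1 := one_lt_of_mem_completion hX hk
        rwa [show m + (s + (k.length - 1)) = m + s + k.length - 1 by omega]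

theorem sat_of_mem_quasiTransAxioms {X : Set ℕ} (hX : X ⊆ {n : ℕ | 1 < n})
    {S : LabelledSet Atm} {V : List (Formula Atm) → Atm → Prop} {F : Formula Atm}
    (hF : F ∈ quasiTransAxioms Atm X) (w : List (Formula Atm)) :
    Sat (TreeRel (completion X) S) V w F := by
  obtain ⟨n, hn, A, rfl⟩ := hF
  rw [sat_imp]
  intro h
  obtain ⟨l, s, hA, hl, hs, -, hnode⟩ := exists_append_of_sat_dia_iterate hX n w h
  have hn' : 1 < n := hX hn
  exact ⟨l ++ w, ⟨hnode (by omega), l, rfl, .inr (hl ▸ hs n (subset_completion X hn))⟩, hA⟩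

/-- Saturation of a set of labelled formulas under the rules, with `Y` the set of lengths of
propagation paths. -/
structure IsSaturated (Y : Set ℕ) (S : LabelledSet Atm) : Prop where
  atom {w p} : (w, Formula.atom p) ∈ S → (w, Formula.natom p) ∉ S
  and {w A B} : (w, Formula.and A B) ∈ S → (w, A) ∈ S ∨ (w, B) ∈ S
  or {w A B} : (w, Formula.or A B) ∈ S → (w, A) ∈ S ∧ (w, B) ∈ S
  box {w A} : (w, Formula.box A) ∈ S → (A :: w, A) ∈ S
  dia {w v A} : (w, Formula.dia A) ∈ S → TreeRel Y S w v → (v, A) ∈ S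

/-- A sequent is read disjunctively, so `S` lists formulas to be made false; this is why an atom is
true exactly where it is absent from `S`. -/
theorem IsSaturated.not_sat {Y : Set ℕ} {S : LabelledSet Atm} (hS : IsSaturated Y S)
    {w : List (Formula Atm)} {A : Formula Atm} (h : (w, A) ∈ S) :
    ¬ Sat (TreeRel Y S) (fun w p => (w, Formula.atom p) ∉ S) w A := by
  induction A generalizing w with
  | atom p => simpa [Sat] using h
  | natom p => simpa [Sat] using fun h' => hS.atom h' h
  | and A B ihA ihB =>
    rintro ⟨hA, hB⟩
    exact (hS.and h).elim (fun h' => ihA h' hA) (fun h' => ihB h' hB)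
  | or A B ihA ihB =>
    exact fun h' => h'.elim (ihA (hS.or h).1) (ihB (hS.or h).2)
  | box A ih =>
    exact fun h' => ih (hS.box h) (h' _ ⟨⟨A, hS.box h⟩, [A], rfl, .inl rfl⟩)
  | dia A ih =>
    rintro ⟨v, hv, hA⟩
    exact ih (hS.dia h hv) hA

/-! ### Sets of labelled formulas without unprovable instances -/

/-- `g` maps the nodes of `T` to nodes of `Θ` that cover the formulas of `T`. -/
structure IsHom (T : LabelledSet Atm) (Θ : LTree Atm) (g : List (Formula Atm) → List ℕ) :
    Prop where
  nil : g [] = []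
  cons {u F C w} : (u, F) ∈ T → (C :: w) <:+ u → ∃ i ∈ Θ.children (g w), g (C :: w) = i :: g w
  covers {u F} : (u, F) ∈ T → Θ.Covers (g u) F

namespace IsHom

variable {T : LabelledSet Atm} {Θ Θ' : LTree Atm} {g : List (Formula Atm) → List ℕ}

theorem insert (h : IsHom T Θ g) {w : List (Formula Atm)} {A : Formula Atm}
    (hw : ∃ F, (w, F) ∈ T) (hA : Θ.Covers (g w) A) : IsHom (insert (w, A) T) Θ g where
  nil := h.nil
  cons := by
    rintro u F C v (hu | hu) hv
    · obtain ⟨rfl, rfl⟩ := Prod.mk.inj hu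
      obtain ⟨F', hF'⟩ := hw
      exact h.cons hF' hv
    · exact h.cons hu hv
  covers := by
    rintro u F (hu | hu)
    · obtain ⟨rfl, rfl⟩ := Prod.mk.inj hu
      exact hA
    · exact h.covers hu

theorem mono (h : IsHom T Θ g) (hl : ∀ u, ∀ A ∈ Θ.label u, Θ'.Covers u A)
    (hc : ∀ u, Θ.children u ⊆ Θ'.children u) : IsHom T Θ' g where
  nil := h.nil
  cons hu hv := (h.cons hu hv).imp fun _ hi => ⟨hc _ hi.1, hi.2⟩
  covers hu := (h.covers hu).mono hl hc

theorem setLabel (h : IsHom T Θ g) {v : List ℕ} {hv : IsNode Θ.children v}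
    {M : Multiset (Formula Atm)} (hM : ∀ A ∈ Θ.label v, (Θ.setLabel v hv M).Covers v A) :
    IsHom T (Θ.setLabel v hv M) g where
  nil := h.nil
  cons := h.cons
  covers hu := (h.covers hu).setLabel hM

theorem isNode (h : IsHom T Θ g) {w : List (Formula Atm)} {F : Formula Atm} (hw : (w, F) ∈ T) :
    IsNode Θ.children (g w) := by
  have : ∀ u, u <:+ w → IsNode Θ.children (g u) := by
    intro u hu
    induction u with
    | nil => rw [h.nil]; trivial
    | cons C u ih =>
      obtain ⟨i, hi, hg⟩ := h.cons hw hu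
      rw [hg]
      exact ⟨hi, ih ((List.suffix_cons C u).trans hu)⟩
  exact this w List.suffix_rfl

theorem exists_append (h : IsHom T Θ g) {w l : List (Formula Atm)} {F : Formula Atm}
    (hw : (l ++ w, F) ∈ T) : ∃ k : List ℕ, k.length = l.length ∧ g (l ++ w) = k ++ g w := by
  have : ∀ u, u <:+ l → ∃ k : List ℕ, k.length = u.length ∧ g (u ++ w) = k ++ g w := by
    intro u hu
    induction u with
    | nil => exact ⟨[], rfl, rfl⟩
    | cons C u ih =>
      obtain ⟨k, hk, hg⟩ := ih ((List.suffix_cons C u).trans hu)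
      obtain ⟨i, -, hi⟩ := h.cons hw (C := C) (w := u ++ w) (by
        obtain ⟨t, rfl⟩ := hu
        exact ⟨t, by simp⟩)
      exact ⟨i :: k, by simp [hk], by simp [hi, hg]⟩
  exact this l List.suffix_rfl

end IsHom

namespace LTree

theorem mem_label_setLabel {Θ : LTree Atm} {w : List ℕ} {hw : IsNode Θ.children w}
    {M : Multiset (Formula Atm)} {A : Formula Atm} (h : A ∈ M) :
    A ∈ (Θ.setLabel w hw M).label w := by
  simpa [setLabel] using h

theorem covers_addChild (Θ : LTree Atm) (w : List ℕ) (hw : IsNode Θ.children w)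
    (M : Multiset (Formula Atm)) (i : ℕ) (A : Formula Atm) :
    i ∈ (Θ.addChild w hw M i A).children w ∧ (Θ.addChild w hw M i A).Covers (i :: w) A :=
  ⟨by simp [addChild], covers_of_mem (by simp [addChild])⟩

end LTree

namespace IsHom

variable {T : LabelledSet Atm} {Θ Θ' : LTree Atm} {g : List (Formula Atm) → List ℕ}

open Classical in
theorem insert_child (h : IsHom T Θ g) {w : List (Formula Atm)} {A F : Formula Atm}
    (hw : (w, F) ∈ T) (hA : ∀ u B, (u, B) ∈ T → ¬ (A :: w) <:+ u) {i : ℕ}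
    (hi : i ∈ Θ.children (g w)) (hc : Θ.Covers (i :: g w) A) :
    IsHom (Insert.insert (A :: w, A) T) Θ (Function.update g (A :: w) (i :: g w)) where
  nil := by rw [Function.update_of_ne (by simp), h.nil]
  cons := by
    have key : ∀ {u B C v}, (u, B) ∈ T → (C :: v) <:+ u →
        ∃ j ∈ Θ.children (Function.update g (A :: w) (i :: g w) v),
          Function.update g (A :: w) (i :: g w) (C :: v) =
            j :: Function.update g (A :: w) (i :: g w) v := by
      intro u B C v hu hv
      -- By freshness no node of `T` lies at or beyond `A :: w`, so changing `g` there does not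
      -- disturb the branches already mapped.
      have h₁ : C :: v ≠ A :: w := fun e => hA u B hu (e ▸ hv)
      have h₂ : v ≠ A :: w := fun e => hA u B hu (e ▸ (List.suffix_cons C v).trans hv)
      rw [Function.update_of_ne h₁, Function.update_of_ne h₂]
      exact h.cons hu hv
    rintro u B C v (hu | hu) hv
    · obtain ⟨rfl, rfl⟩ := Prod.mk.inj hu
      obtain hv | hv := List.suffix_cons_iff.1 hv
      · obtain ⟨rfl, rfl⟩ := List.cons.inj hv
        refine ⟨i, ?_, ?_⟩
        · rwa [Function.update_of_ne (by simp)]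
        · rw [Function.update_self, Function.update_of_ne (by simp)]
      · exact key hw hv
    · exact key hu hv
  covers := by
    rintro u B (hu | hu)
    · obtain ⟨rfl, rfl⟩ := Prod.mk.inj hu
      rwa [Function.update_self]
    · rw [Function.update_of_ne]
      · exact h.covers hu
      · rintro rfl
        exact hA _ _ hu List.suffix_rfl

theorem addChild (h : IsHom T Θ g) {v : List ℕ} {hv : IsNode Θ.children v} {A : Formula Atm}
    {M : Multiset (Formula Atm)} (hM : Θ.label v = A.box ::ₘ M) {i : ℕ}
    (hi : i ∉ Θ.children v) : IsHom T (Θ.addChild v hv M i A) g := by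
  refine h.mono (fun u B hB => ?_) (LTree.subset_update_insert _ _ _)
  by_cases hu : u = v
  · subst hu
    rw [hM, Multiset.mem_cons] at hB
    obtain rfl | hB := hB
    -- The box is gone from the label but stays covered by the new child.
    · exact .inr ⟨i, Θ.covers_addChild u hv M i A⟩
    · exact LTree.covers_of_mem (by simpa [LTree.addChild] using hB)
  · have hu' : u ≠ i :: v := by
      rintro rfl
      exact hi (Θ.isNode_of_mem hB).1
    exact LTree.covers_of_mem
      (by simpa [LTree.addChild, Function.update_of_ne hu, Function.update_of_ne hu'] using hB)

end IsHom

/-- The system `nK` with the propagation rules for path lengths in `Y`. -/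
abbrev nKPlus (Atm : Type u) (Y : Set ℕ) : NestedSystem Atm := NestedSystem.plus nK (diaKRules Y)

theorem provable_of_nK {Y : Set ℕ} {Γs : List (Sequent Atm)} {Γ : Sequent Atm} (h : nK Γs Γ)
    (hΓs : ∀ Δ ∈ Γs, Provable (nKPlus Atm Y) Δ) : Provable (nKPlus Atm Y) Γ :=
  .rule Γs Γ (.inl h) hΓs

/-- Length `1` is handled by the diamond rule of `nK` itself, so `Y` need not contain `1`. -/
theorem provable_of_chain {Y : Set ℕ} (C : Context Atm) (A : Formula Atm)
    (Δs : List (Sequent Atm)) (hΔs : Δs.length = 1 ∨ 1 ≤ Δs.length ∧ Δs.length ∈ Y)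
    (h : Provable (nKPlus Atm Y)
      (C.fill (Sequent.single A.dia + Sequent.chain Δs (Sequent.single A)))) :
    Provable (nKPlus Atm Y) (C.fill (Sequent.single A.dia + Sequent.chain Δs ∅)) := by
  obtain hΔs | ⟨h1, hΔs⟩ := hΔs
  · obtain ⟨Δ, rfl⟩ := List.length_eq_one_iff.1 hΔs
    simp only [Sequent.chain, Sequent.empty_eq_zero, add_zero] at h ⊢
    rw [add_comm Δ] at h
    exact provable_of_nK (.dia C A Δ) (by simpa using h)
  · exact .rule [_] _ (.inr ⟨_, hΔs, .mk h1 C A Δs rfl⟩) (by simpa using h)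

/-- All sequents into which `T` can be mapped are provable. -/
def Refutes (Y : Set ℕ) (T : LabelledSet Atm) : Prop :=
  ∀ Θ g, IsHom T Θ g → Provable (nKPlus Atm Y) Θ.toSequent

/-! ### The rules of the calculus as closure properties of `Refutes` -/

namespace Refutes

variable {Y : Set ℕ} {T T' : LabelledSet Atm} {w : List (Formula Atm)} {A B : Formula Atm}

/-- Mappings restrict to subsets; this plays the role of weakening. -/
theorem mono (h : Refutes Y T) (hT : T ⊆ T') : Refutes Y T' := fun Θ g hg =>
  h Θ g ⟨hg.nil, fun hu => hg.cons (hT hu), fun hu => hg.covers (hT hu)⟩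

theorem id {p : Atm} (hp : (w, .atom p) ∈ T) (hn : (w, .natom p) ∈ T) : Refutes Y T := by
  intro Θ g hg
  have hp' : .atom p ∈ Θ.label (g w) := hg.covers hp
  have hn' : .natom p ∈ Θ.label (g w) := hg.covers hn
  obtain ⟨C, hC, -⟩ := Θ.exists_context_setLabel (g w) (hg.isNode hp)
  obtain ⟨M, hM⟩ := Multiset.exists_cons_of_mem hp'
  obtain ⟨N, rfl⟩ : ∃ N, M = .natom p ::ₘ N :=
    Multiset.exists_cons_of_mem (by simpa [hM] using hn')
  have := provable_of_nK (Y := Y) (.id (C.extend (Sequent.ofMultiset N)) p) (by simp)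
  rw [Context.fill_extend] at this
  rw [hC, hM, Sequent.ofMultiset_cons, Sequent.ofMultiset_cons]
  convert this using 2
  abel

/-- Either the disjunction itself stands in the target, and the rule is applied to it while all old
formulas remain covered; or it has been decomposed already, and the target covers both disjuncts
without any rule. The conjunction and box cases follow the same division. -/
theorem or (h : (w, .or A B) ∈ T) (hT : Refutes Y (insert (w, B) (insert (w, A) T))) :
    Refutes Y T := by
  intro Θ g hg
  have hins : ∀ {Θ'}, IsHom T Θ' g → Θ'.Covers (g w) A → Θ'.Covers (g w) B →
      Provable (nKPlus Atm Y) Θ'.toSequent := fun hg' hA hB =>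
    hT _ g ((hg'.insert ⟨_, h⟩ hA).insert ⟨_, .inr h⟩ hB)
  obtain hmem | ⟨hA, hB⟩ := hg.covers h
  · obtain ⟨M, hM⟩ := Multiset.exists_cons_of_mem hmem
    have hw := hg.isNode h
    obtain ⟨C, hC, hC'⟩ := Θ.exists_context_setLabel (g w) hw
    have hA : (Θ.setLabel (g w) hw (A ::ₘ B ::ₘ M)).Covers (g w) A :=
      LTree.covers_of_mem (LTree.mem_label_setLabel (by simp))
    have hB : (Θ.setLabel (g w) hw (A ::ₘ B ::ₘ M)).Covers (g w) B :=
      LTree.covers_of_mem (LTree.mem_label_setLabel (by simp))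
    have := hins (hg.setLabel (hv := hw) (M := A ::ₘ B ::ₘ M) fun F hF => by
      rw [hM, Multiset.mem_cons] at hF
      obtain rfl | hF := hF
      · exact .inr ⟨hA, hB⟩
      · exact LTree.covers_of_mem (LTree.mem_label_setLabel (by simp [hF]))) hA hB
    rw [hC', Sequent.ofMultiset_cons, Sequent.ofMultiset_cons, ← add_assoc, add_comm,
      ← Context.fill_extend] at this
    rw [hC, hM, Sequent.ofMultiset_cons, add_comm, ← Context.fill_extend]
    exact provable_of_nK (.or _ A B) (by simpa using this)
  · exact hins hg hA hB

theorem and (h : (w, .and A B) ∈ T) (hA : Refutes Y (insert (w, A) T))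
    (hB : Refutes Y (insert (w, B) T)) : Refutes Y T := by
  intro Θ g hg
  obtain hmem | hcov | hcov := hg.covers h
  · obtain ⟨M, hM⟩ := Multiset.exists_cons_of_mem hmem
    have hw := hg.isNode h
    obtain ⟨C, hC, hC'⟩ := Θ.exists_context_setLabel (g w) hw
    have key : ∀ F, (∀ Θ' : LTree Atm, Θ'.Covers (g w) F → Θ'.Covers (g w) (A.and B)) →
        Refutes Y (insert (w, F) T) →
        Provable (nKPlus Atm Y) ((C.extend (Sequent.ofMultiset M)).fill (Sequent.single F)) := by
      intro F hF hT
      have hF' : (Θ.setLabel (g w) hw (F ::ₘ M)).Covers (g w) F :=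
        LTree.covers_of_mem (LTree.mem_label_setLabel (by simp))
      have := hT _ g (IsHom.insert (hg.setLabel (hv := hw) (M := F ::ₘ M) fun G hG => by
        rw [hM, Multiset.mem_cons] at hG
        obtain rfl | hG := hG
        · exact hF _ hF'
        · exact LTree.covers_of_mem (LTree.mem_label_setLabel (by simp [hG]))) ⟨_, h⟩ hF')
      rwa [hC', Sequent.ofMultiset_cons, add_comm, ← Context.fill_extend] at this
    rw [hC, hM, Sequent.ofMultiset_cons, add_comm, ← Context.fill_extend]
    refine provable_of_nK (.and _ A B) ?_
    simpa using ⟨key A (fun _ h => .inr (.inl h)) hA, key B (fun _ h => .inr (.inr h)) hB⟩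
  · exact hA Θ g (hg.insert ⟨_, h⟩ hcov)
  · exact hB Θ g (hg.insert ⟨_, h⟩ hcov)

theorem box (h : (w, .box A) ∈ T) (hfresh : ∀ u F, (u, F) ∈ T → ¬ (A :: w) <:+ u)
    (hT : Refutes Y (insert (A :: w, A) T)) : Refutes Y T := by
  intro Θ g hg
  obtain hmem | ⟨i, hi, hcov⟩ := hg.covers h
  · obtain ⟨M, hM⟩ := Multiset.exists_cons_of_mem hmem
    obtain ⟨i, hi⟩ := Infinite.exists_notMem_finset (Θ.children (g w))
    obtain ⟨C, hC, hC'⟩ := Θ.exists_context_addChild (g w) (hg.isNode h) A.box M hM i hi A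
    rw [hC]
    refine provable_of_nK (.box C A) ?_
    obtain ⟨hi', hcov⟩ := Θ.covers_addChild (g w) (hg.isNode h) M i A
    simpa [← hC'] using hT _ _ ((hg.addChild hM hi).insert_child h hfresh hi' hcov)
  -- The box has been unfolded before: `A :: w` is sent to the existing child. Mappings need not be
  -- injective, so it does not matter whether this child is already an image.
  · exact hT Θ _ (hg.insert_child h hfresh hi hcov)

theorem dia {l : List (Formula Atm)} {F : Formula Atm} (h : (w, .dia A) ∈ T)
    (hl : l.length = 1 ∨ 1 ≤ l.length ∧ l.length ∈ Y) (hF : (l ++ w, F) ∈ T)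
    (hT : Refutes Y (insert (l ++ w, A) T)) : Refutes Y T := by
  intro Θ g hg
  obtain ⟨k, hk, hgk⟩ := hg.exists_append hF
  have hmem : A.dia ∈ Θ.label (g w) := hg.covers h
  have hnode : IsNode Θ.children (k ++ g w) := hgk ▸ hg.isNode hF
  -- Mappings preserve path lengths, so the image path has a length that the propagation rule
  -- permits.
  obtain ⟨C, Δs, hΔs, hC, hC'⟩ := Θ.exists_chain_setLabel A.dia A (g w) k
    (by rintro rfl; simp at hk; omega) hmem hnode
  rw [hC]
  refine provable_of_chain C A Δs (by rwa [hΔs, hk]) ?_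
  rw [← hC']
  refine hT _ g (IsHom.insert (hg.setLabel fun G hG => ?_) ⟨F, hF⟩ ?_)
  · exact LTree.covers_of_mem (LTree.mem_label_setLabel (by simp [hG]))
  · rw [hgk]
    exact LTree.covers_of_mem (LTree.mem_label_setLabel (by simp))

end Refutes

/-! ### Maximal consistent labelled sets -/

/-- Some finite subset of `S` has only provable instances. -/
def Inconsistent (Y : Set ℕ) (S : LabelledSet Atm) : Prop :=
  ∃ T ⊆ S, T.Finite ∧ Refutes Y T

/-- Separates the finite witness from the added formulas `E`. The set `P` keeps the principal
formula of the intended rule available, and allowing every larger `T'` lets the witnesses of the two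
premisses for a conjunction be united. -/
theorem Inconsistent.exists_insert {Y : Set ℕ} {S : LabelledSet Atm} {E P : LabelledSet Atm}
    (h : Inconsistent Y (E ∪ S)) (hP : P ⊆ S) (hfin : P.Finite) :
    ∃ T ⊆ S, T.Finite ∧ P ⊆ T ∧ ∀ T', T ⊆ T' → Refutes Y (E ∪ T') := by
  obtain ⟨T, hT, hTfin, h⟩ := h
  refine ⟨P ∪ T ∩ S, Set.union_subset hP Set.inter_subset_right,
    hfin.union (hTfin.subset Set.inter_subset_left), Set.subset_union_left, fun T' hT' =>
    h.mono fun x hx => (hT hx).imp_right fun hxS => hT' (.inr ⟨hx, hxS⟩)⟩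

/-- Every node other than the root is created by a box at its parent. -/
def IsTreelike (S : LabelledSet Atm) : Prop :=
  ∀ C w F, (C :: w, F) ∈ S → (C :: w, C) ∈ S ∧ (w, C.box) ∈ S

theorem IsTreelike.insert {S : LabelledSet Atm} (hS : IsTreelike S) {w : List (Formula Atm)}
    {A F : Formula Atm} (hw : (w, F) ∈ S) : IsTreelike (insert (w, A) S) := by
  rintro C v G (h | h)
  · obtain ⟨rfl, rfl⟩ := Prod.mk.inj h
    exact (hS C v F hw).imp .inr .inr
  · exact (hS C v G h).imp .inr .inr

theorem IsTreelike.insert_child {S : LabelledSet Atm} (hS : IsTreelike S)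
    {w : List (Formula Atm)} {A : Formula Atm} (hw : (w, A.box) ∈ S) :
    IsTreelike (Insert.insert (A :: w, A) S) := by
  rintro C v G (h | h)
  · obtain ⟨h, rfl⟩ := Prod.mk.inj h
    obtain ⟨rfl, rfl⟩ := List.cons.inj h
    exact ⟨.inl rfl, .inr hw⟩
  · exact (hS C v G h).imp .inr .inr

/-- Supplies the freshness condition of the box case: if `(A :: w, A)` is missing from `S`, then no
node of `S` lies at or beyond `A :: w`. -/
theorem IsTreelike.exists_of_suffix {S : LabelledSet Atm} (hS : IsTreelike S)
    {u : List (Formula Atm)} {F C : Formula Atm} (hu : (u, F) ∈ S) {w : List (Formula Atm)}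
    (h : (C :: w) <:+ u) : (C :: w, C) ∈ S := by
  induction u generalizing F with
  | nil => simp at h
  | cons D u ih =>
    obtain h | h := List.suffix_cons_iff.1 h
    · obtain ⟨rfl, rfl⟩ := List.cons.inj h
      exact (hS _ _ _ hu).1
    · exact ih (hS _ _ _ hu).2 h

theorem exists_maximal_consistent {Y : Set ℕ} {S₀ : LabelledSet Atm} (hS₀ : IsTreelike S₀)
    (h : ¬ Inconsistent Y S₀) : ∃ S, S₀ ⊆ S ∧
      Maximal (fun S : LabelledSet Atm => IsTreelike S ∧ ¬ Inconsistent Y S) S := by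
  refine zorn_subset_nonempty {S : LabelledSet Atm | IsTreelike S ∧ ¬ Inconsistent Y S}
    (fun c hc hchain hne => ⟨⋃₀ c, ⟨?_, ?_⟩, fun s hs => Set.subset_sUnion_of_mem hs⟩) S₀ ⟨hS₀, h⟩
  · rintro C w F ⟨s, hs, hF⟩
    exact ((hc hs).1 C w F hF).imp (fun h => ⟨s, hs, h⟩) (fun h => ⟨s, hs, h⟩)
  · rintro ⟨T, hT, hfin, hR⟩
    obtain ⟨s, hs, hTs⟩ := DirectedOn.exists_mem_subset_of_finite_of_subset_sUnion hne
      hchain.directedOn hfin hT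
    exact (hc hs).2 ⟨T, hTs, hfin, hR⟩

theorem isSaturated_of_maximal {Y : Set ℕ} (hY : ∀ n ∈ Y, 1 ≤ n) {S : LabelledSet Atm}
    (hS : Maximal (fun S : LabelledSet Atm => IsTreelike S ∧ ¬ Inconsistent Y S) S) :
    IsSaturated Y S := by
  obtain ⟨⟨htree, hcons⟩, -⟩ := id hS
  -- By maximality, whatever can be added without losing treelikeness or consistency is already
  -- present. Each clause below refutes the addition by the matching rule.
  have key : ∀ E : LabelledSet Atm, IsTreelike (E ∪ S) → ¬ Inconsistent Y (E ∪ S) → E ⊆ S :=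
    fun E h₁ h₂ => Set.subset_union_left.trans (hS.2 ⟨h₁, h₂⟩ Set.subset_union_right)
  refine ⟨?_, ?_, ?_, ?_, ?_⟩
  · intro w p hp hn
    exact hcons ⟨{(w, .atom p), (w, .natom p)}, by simp [Set.insert_subset_iff, hp, hn],
      by simp, Refutes.id (w := w) (p := p) (by simp) (by simp)⟩
  · intro w A B h
    by_contra! hAB
    have hinc : ∀ F, (w, F) ∉ S → Inconsistent Y ({(w, F)} ∪ S) := fun F hF => by
      by_contra hc
      exact hF (key {(w, F)} (htree.insert h) hc rfl)
    obtain ⟨T₁, hS₁, hf₁, hP₁, hT₁⟩ := (hinc A hAB.1).exists_insert (P := {(w, A.and B)})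
      (by simpa using h) (by simp)
    obtain ⟨T₂, hS₂, hf₂, -, hT₂⟩ := (hinc B hAB.2).exists_insert (P := {(w, A.and B)})
      (by simpa using h) (by simp)
    exact hcons ⟨T₁ ∪ T₂, Set.union_subset hS₁ hS₂, hf₁.union hf₂,
      Refutes.and (.inl (hP₁ rfl)) (hT₁ _ Set.subset_union_left) (hT₂ _ Set.subset_union_right)⟩
  · intro w A B h
    -- Both disjuncts are added at once, since the premiss of the rule contains both.
    have hsub := key {(w, B), (w, A)}
      (by
        rw [Set.insert_union]
        exact IsTreelike.insert (F := A.or B) (htree.insert h) (.inr h))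
      (fun hinc => by
        obtain ⟨T, hTS, hfin, hPT, hT⟩ := hinc.exists_insert (P := {(w, A.or B)})
          (by simpa using h) (by simp)
        have := hT T subset_rfl
        rw [Set.insert_union] at this
        exact hcons ⟨T, hTS, hfin, Refutes.or (hPT rfl) this⟩)
    exact ⟨hsub (by simp), hsub (by simp)⟩
  · intro w A h
    by_contra hnot
    refine hnot (key {(A :: w, A)} (htree.insert_child h) (fun hinc => ?_) rfl)
    obtain ⟨T, hTS, hfin, hPT, hT⟩ := hinc.exists_insert (P := {(w, A.box)}) (by simpa using h)
      (by simp)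
    exact hcons ⟨T, hTS, hfin, Refutes.box (hPT rfl)
      (fun u F hu hw => hnot (htree.exists_of_suffix (hTS hu) hw)) (hT T subset_rfl)⟩
  · rintro w v A h ⟨⟨F, hF⟩, l, rfl, hl⟩
    by_contra hnot
    refine hnot (key {(l ++ w, A)} (htree.insert hF) (fun hinc => ?_) rfl)
    obtain ⟨T, hTS, hfin, hPT, hT⟩ := hinc.exists_insert (P := {(w, A.dia), (l ++ w, F)})
      (by simp [Set.insert_subset_iff, h, hF]) (by simp)
    exact hcons ⟨T, hTS, hfin, Refutes.dia (hPT (.inl rfl))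
      (hl.imp_right fun h => ⟨hY _ h, h⟩) (hPT (.inr rfl)) (hT T subset_rfl)⟩

/-- The one-node tree with label `{A}` is a target for any subset of the singleton, and its sequent
is `A` alone. -/
theorem not_inconsistent_singleton {Y : Set ℕ} {A : Formula Atm}
    (h : ¬ Provable (nKPlus Atm Y) (Sequent.single A)) :
    ¬ Inconsistent Y {(([] : List (Formula Atm)), A)} := by
  rintro ⟨T, hT, -, hR⟩
  have := (hR.mono hT) ⟨fun w => if w = [] then {A} else 0, fun _ => ∅, 0,
    fun w hw => by
      by_cases h : w = []
      · subst h; trivial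
      · simp [h] at hw, by simp, by simp⟩ (fun _ => [])
    { nil := rfl
      cons := by
        intro u F C w hu hw
        obtain ⟨rfl, rfl⟩ := Prod.mk.inj hu
        simp at hw
      covers := by
        intro u F hu
        obtain ⟨rfl, rfl⟩ := Prod.mk.inj hu
        exact LTree.covers_of_mem (by simp) }
  exact h (by simpa [LTree.toSequent, seqAt] using this)

/-- Completeness of `nK` with propagation rules, relative to the tree models of labelled sets. -/
theorem provable_single_of_sat {Y : Set ℕ} (hY : ∀ n ∈ Y, 1 ≤ n) {A : Formula Atm}
    (h : ∀ (S : LabelledSet Atm) (V : List (Formula Atm) → Atm → Prop),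
      Sat (TreeRel Y S) V [] A) :
    Provable (nKPlus Atm Y) (Sequent.single A) := by
  by_contra hA
  obtain ⟨S, hAS, hS⟩ := exists_maximal_consistent
    (S₀ := {(([] : List (Formula Atm)), A)}) (by intro C w F h; simp at h)
    (not_inconsistent_singleton hA)
  exact (isSaturated_of_maximal hY hS).not_sat (hAS rfl) (h S _)

end NestedModal

theorem corollary1 {Atm : Type u} (X : Set ℕ) (hX : X ⊆ {n : ℕ | 1 < n})
    (A : NestedModal.Formula Atm)
    (hA : NestedModal.KProvable (NestedModal.quasiTransAxioms Atm X) A) :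
    NestedModal.Provable
      (NestedModal.NestedSystem.plus NestedModal.nK
        (NestedModal.diaKRules (NestedModal.completion X)))
      (NestedModal.Sequent.single A) :=
  NestedModal.provable_single_of_sat
    (fun _ hn => (NestedModal.one_lt_of_mem_completion hX hn).le)
    fun _ _ => NestedModal.sat_of_kProvable
      (fun _ hF => NestedModal.sat_of_mem_quasiTransAxioms hX hF) hA []
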